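/- **Setting.** Let $K\ge 1$, and let $n_0=n_T$, $n_k=n_S$ for $k\in[K]=\{1,\dots,K\}$, $N=Kn_S+n_T$. One observes $y^{(k)}=X^{(k)}(\beta+\delta^{(k)})+\varepsilon^{(k)}\in\mathbb R^{n_k}$ for $0\le k\le K$, where $\delta^{(0)}=0$, $\beta,\delta^{(1)},\dots,\delta^{(K)}\in\mathbb R^p$ are fixed, and: (A1) the rows $X^{(k)}_{i\cdot}$ ($0\le k\le K$, $1\le i\le n_k$) are independent, mean-zero, sub-Gaussian random vectors with common sub-Gaussian parameter $\kappa$ (that is, $\mathbb E\, e^{t\langle u,X^{(k)}_{i\cdot}\rangle}\le e^{\kappa t^2/2}$ for all $t\in\mathbb R$ and all unit vectors $u$), with covariance $\Sigma^{(k)}$ all of whose eigenvalues lie in $[1/c_X,c_X]$; (A2) the $\varepsilon^{(k)}_i$ are independent centred Gaussian variables with variance $\sigma_k\le c_\varepsilon$ in task $k$, and the noise is independent of the design. Put $S_0=\{j:\beta_j\ne0\}$ and $S_k=\{j:\delta^{(k)}_j\neq 0\}$. An *oracle estimator* is a minimizer $(b,d^{(1)},\dots,d^{(K)})$ of $\frac1N\sum_{k=0}^K\|y^{(k)}-X^{(k)}(b+d^{(k)})\|_2^2$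 (with $d^{(0)}=0$) subject to $b_{S_0^c}=0$ and $d^{(k)}_{S_k^c}=0$ for $k\in[K]$. The *weighted fused Lasso* with weights $w^{(k)}_j$ is $$\min_{b,d^{(1)},\dots,d^{(K)}}\ \frac1N\sum_{k=0}^K\|y^{(k)}-X^{(k)}(b+d^{(k)})\|_2^2+\lambda_0\sum_{j=1}^p w^{(0)}_j|b_j|+\lambda_1\sum_{k=1}^K\sum_{j=1}^p w^{(k)}_j|d^{(k)}_j| .$$ A family of *folded-concave penalties* with constants $a>a_2\ge0$, $a_1>0$ is a family $(\mathcal R_\lambda)_{\lambda>0}$ of nondecreasing concave differentiable functions on $[0,\infty)$ (with right derivative at $0$) such that $\mathcal R_\lambda(0)=0$, $\mathcal R_\lambda'(t)\ge a_1\lambda$ for $0\le t\le a_2\lambda$, and $\mathcal R'_\lambda(t)=0$ for $t\ge a\lambda$. **Theorem.** Fix constants $c_X>0$, $\kappa$, $c_\varepsilon$, $c_n>0$, $M$, $a>a_2\ge0$, $a_1>0$. There are constants $C_0,C_1,c_1>0$ depending only on these such that the following holds for all $K\ge1$, $n_T$, $n_S$, $p$ with $n_S\ge c_n\log p$ and $\log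 K\le M\log p$. Assume (A1) and (A2), let $\lambda_0,\lambda_1>0$ satisfy $$\lambda_0\ge C_0\sqrt{\frac{\log p}{N}},\qquad \lambda_1\ge C_1\,\frac{n_S}{N}\sqrt{\frac{\log p}{n_S}},$$ and let $h_0^\wedge\ge\frac{3a}{2}\lambda_0$ and $h_k^\wedge\ge\frac{3a}2\lambda_1$ for $k\in[K]$. Suppose $(\beta,\delta^{(1)},\dots,\delta^{(K)})\in\Theta_1$, that is, $|\beta_j|\ge h_0^\wedge$ for $j\in S_0$ and $|\delta^{(k)}_j|\ge h_k^\wedge$ for $j\in S_k$, $k\in[K]$. Let $(\mathcal R_\lambda)$ be a family of folded-concave penalties with constants $a,a_1,a_2$, let $\hat\beta_{\rm init}$, $\hat\delta^{(k)}_{\rm init}$ be (random) initial estimators, and use the weights $$w^{(0)}_j=\lambda_0^{-1}\mathcal R'_{\lambda_0}(|\hat\beta_{{\rm init},j}|),\qquad w^{(k)}_j=\lambda_1^{-1}\mathcal R'_{\lambda_1}(|\hat\delta^{(k)}_{{\rm init},j}|).$$ Then there is an event of probability at least $1-\exp(-c_1\log p)$ on which, whenever the initial estimators satisfy $$\|\hat\beta_{\rm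 init}-\beta\|_\infty\le\tfrac{a_2}2\lambda_0,\qquad \|\hat\delta^{(k)}_{\rm init}-\delta^{(k)}\|_\infty\le\tfrac{a_2}2\lambda_1\quad(k\in[K]),$$ the weighted fused Lasso has a solution and its solutions are exactly the oracle estimators. In particular, if the initial estimators always satisfy these bounds, the weighted fused-Lasso solution is the oracle estimator with probability at least $1-\exp(-c_1\log p)$. -/

import Mathlib

namespace AdaTrans

open MeasureTheory ProbabilityTheory

/-- Sample sizes: task `0` is the target (size `nT`), tasks `1, …, K` are the sources (size `nS`). -/
def taskSize (K nT nS : ℕ) : Fin (K + 1) → ℕ := Fin.cons nT (fun _ => nS)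

/-- The index set of all observations: pairs (task `k`, observation `i` of task `k`). -/
abbrev Obs (K nT nS : ℕ) : Type := Σ k : Fin (K + 1), Fin (taskSize K nT nS k)

/-- The total sample size `N = K nS + nT`. -/
def totalSize (K nT nS : ℕ) : ℕ := K * nS + nT

/-- A family of contrasts `δ⁽¹⁾, …, δ⁽ᴷ⁾`, extended by `δ⁽⁰⁾ = 0`. -/
def extend {K p : ℕ} (d : Fin K → Fin p → ℝ) : Fin (K + 1) → Fin p → ℝ := Fin.cons 0 d

/-- The response of the linear model `y⁽ᵏ⁾ = X⁽ᵏ⁾ (β + δ⁽ᵏ⁾) + ε⁽ᵏ⁾` (with `δ⁽⁰⁾ = 0`). -/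
def response {K nT nS p : ℕ} (X : Obs K nT nS → Fin p → ℝ) (eps : Obs K nT nS → ℝ)
    (β : Fin p → ℝ) (δ : Fin K → Fin p → ℝ) : Obs K nT nS → ℝ :=
  fun o => X o ⬝ᵥ (β + extend δ o.1) + eps o

/-- A centred random vector is sub-Gaussian with parameter `κ` if all its one-dimensional marginals
along Euclidean unit vectors `u` satisfy `E exp(t ⟨u, V⟩) ≤ exp(κ t² / 2)` for every real `t`. -/
def IsSubGaussianVector {Ω : Type*} [MeasurableSpace Ω] {p : ℕ} (V : Ω → Fin p → ℝ) (κ : NNReal)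
    (μ : Measure Ω) : Prop :=
  ∀ u : Fin p → ℝ, ∑ j, u j ^ 2 = 1 → HasSubgaussianMGF (fun ω => u ⬝ᵥ V ω) κ μ

/-- The assumption on the design: the rows are independent, centred, sub-Gaussian, the rows of
task `k` have covariance matrix `Sig k`, and all eigenvalues of all these matrices lie
in `[1/c, c]`. -/
structure DesignAssumption {Ω : Type*} [MeasurableSpace Ω] {K nT nS p : ℕ} (μ : Measure Ω)
    (X : Obs K nT nS → Ω → Fin p → ℝ) (Sig : Fin (K + 1) → Matrix (Fin p) (Fin p) ℝ)
    (κ : NNReal) (c : ℝ) : Prop where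
  measurable : ∀ o, Measurable (X o)
  indep : iIndepFun X μ
  subGaussian : ∀ o, IsSubGaussianVector (X o) κ μ
  mean_zero : ∀ o j, ∫ ω, X o ω j ∂μ = 0
  covariance : ∀ o j l, ∫ ω, X o ω j * X o ω l ∂μ = Sig o.1 j l
  symm : ∀ k, (Sig k).IsSymm
  eigenvalues : ∀ k t, Module.End.HasEigenvalue (Matrix.toLin' (Sig k)) t → 1 / c ≤ t ∧ t ≤ c

/-- The assumption on the noise: independent centred Gaussian variables, with variance
`v k ≤ c` in task `k`, independent of the design. -/
structure NoiseAssumption {Ω : Type*} [MeasurableSpace Ω] {K nT nS p : ℕ} (μ : Measure Ω)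
    (X : Obs K nT nS → Ω → Fin p → ℝ) (eps : Obs K nT nS → Ω → ℝ) (v : Fin (K + 1) → NNReal)
    (c : ℝ) : Prop where
  measurable : ∀ o, Measurable (eps o)
  indep : iIndepFun eps μ
  gaussian : ∀ o, HasLaw (eps o) (gaussianReal 0 (v o.1)) μ
  variance_le : ∀ k, (v k : ℝ) ≤ c
  indep_design : IndepFun (fun ω o => eps o ω) (fun ω o => X o ω) μ

/-- The parameter space of pairs `(β, (δ⁽ᵏ⁾)ₖ)` whose nonzero entries have absolute value at
least `h0` (for `β`) and `h k` (for `δ⁽ᵏ⁾`). -/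
def Theta1 {K p : ℕ} (h0 : ℝ) (h : Fin K → ℝ) : Set ((Fin p → ℝ) × (Fin K → Fin p → ℝ)) :=
  {θ | (∀ j, θ.1 j ≠ 0 → h0 ≤ |θ.1 j|) ∧ ∀ k j, θ.2 k j ≠ 0 → h k ≤ |θ.2 k j|}

/-- The derivative `R'_lam(t)` for `t ≥ 0` of a penalty; at `t = 0` it is the right derivative. -/
noncomputable def penaltyDeriv (R : ℝ → ℝ → ℝ) (lam t : ℝ) : ℝ :=
  derivWithin (R lam) (Set.Ici 0) t

/-- Folded-concave penalties with constants `a`, `a₁`, `a₂`. Only the values `R lam t` with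
`lam > 0`, `t ≥ 0` matter; the penalty of a real number `x` is `R lam |x|`. -/
structure IsFoldedConcave (R : ℝ → ℝ → ℝ) (a a₁ a₂ : ℝ) : Prop where
  zero : ∀ lam > 0, R lam 0 = 0
  mono : ∀ lam > 0, MonotoneOn (R lam) (Set.Ici 0)
  concave : ∀ lam > 0, ConcaveOn ℝ (Set.Ici 0) (R lam)
  diff : ∀ lam > 0, DifferentiableOn ℝ (R lam) (Set.Ici 0)
  deriv_ge : ∀ lam > 0, ∀ t, 0 ≤ t → t ≤ a₂ * lam → a₁ * lam ≤ penaltyDeriv R lam t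
  deriv_eq_zero : ∀ lam > 0, ∀ t, a * lam ≤ t → penaltyDeriv R lam t = 0

/-- The weight `lam⁻¹ R'_lam(|x|)` attached to an initial estimate `x` of a coordinate. -/
noncomputable def weight (R : ℝ → ℝ → ℝ) (lam x : ℝ) : ℝ := lam⁻¹ * penaltyDeriv R lam |x|

/-- The fit term `N⁻¹ ∑ₖ ‖y⁽ᵏ⁾ - X⁽ᵏ⁾ (b + d⁽ᵏ⁾)‖₂²` (with `d⁽⁰⁾ = 0`). -/
noncomputable def loss {K nT nS p : ℕ} (X : Obs K nT nS → Fin p → ℝ) (y : Obs K nT nS → ℝ)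
    (θ : (Fin p → ℝ) × (Fin K → Fin p → ℝ)) : ℝ :=
  (1 / (totalSize K nT nS : ℝ)) *
    ∑ k : Fin (K + 1), ∑ i : Fin (taskSize K nT nS k),
      (y ⟨k, i⟩ - X ⟨k, i⟩ ⬝ᵥ (θ.1 + extend θ.2 k)) ^ 2

/-- The weighted fused-Lasso objective. -/
noncomputable def objective {K nT nS p : ℕ} (X : Obs K nT nS → Fin p → ℝ) (y : Obs K nT nS → ℝ)
    (lam0 lam1 : ℝ) (w0 : Fin p → ℝ) (w : Fin K → Fin p → ℝ)
    (θ : (Fin p → ℝ) × (Fin K → Fin p → ℝ)) : ℝ :=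
  loss X y θ + lam0 * ∑ j, w0 j * |θ.1 j| + lam1 * ∑ k, ∑ j, w k j * |θ.2 k j|

/-- The solutions of the weighted fused-Lasso problem. -/
def lassoSolutions {K nT nS p : ℕ} (X : Obs K nT nS → Fin p → ℝ) (y : Obs K nT nS → ℝ)
    (lam0 lam1 : ℝ) (w0 : Fin p → ℝ) (w : Fin K → Fin p → ℝ) :
    Set ((Fin p → ℝ) × (Fin K → Fin p → ℝ)) :=
  {θ | ∀ θ', objective X y lam0 lam1 w0 w θ ≤ objective X y lam0 lam1 w0 w θ'}

/-- The feasible set of the oracle problem: the zero pattern of the true parameters `(β, δ)`. -/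
def oracleFeasible {K p : ℕ} (β : Fin p → ℝ) (δ : Fin K → Fin p → ℝ) :
    Set ((Fin p → ℝ) × (Fin K → Fin p → ℝ)) :=
  {θ | (∀ j, β j = 0 → θ.1 j = 0) ∧ ∀ k j, δ k j = 0 → θ.2 k j = 0}

/-- The oracle estimators: the solutions of least squares restricted to the true supports. -/
def oracleSolutions {K nT nS p : ℕ} (X : Obs K nT nS → Fin p → ℝ) (y : Obs K nT nS → ℝ)
    (β : Fin p → ℝ) (δ : Fin K → Fin p → ℝ) : Set ((Fin p → ℝ) × (Fin K → Fin p → ℝ)) :=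
  {θ | θ ∈ oracleFeasible β δ ∧ ∀ θ' ∈ oracleFeasible β δ, loss X y θ ≤ loss X y θ'}

/-- Sup-norm accuracy of initial values, to within `(a₂/2) lam0` and `(a₂/2) lam1`. (The norm of
`Fin p → ℝ` is the sup norm.) -/
def Accurate {K p : ℕ} (a₂ lam0 lam1 : ℝ) (β : Fin p → ℝ) (δ : Fin K → Fin p → ℝ)
    (b0 : Fin p → ℝ) (d0 : Fin K → Fin p → ℝ) : Prop :=
  ‖b0 - β‖ ≤ a₂ / 2 * lam0 ∧ ∀ k, ‖d0 k - δ k‖ ≤ a₂ / 2 * lam1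

end AdaTrans

/-! Stacking `β` and all contrasts turns the problem into one weighted Lasso regression; let `S` be
the true joint support. Accurate initial values make every weight on `S` vanish, since the penalty
is flat beyond `a * lam`, and make every penalty coefficient off `S` at least `a₁ * lam`. Expanding
the objective around the least-squares fit on `S` then shows that its minimizers are exactly the
oracle estimators, as soon as the residual's correlation with each column off `S` is below `N * a₁ *
lam / 2` (`lasso_minimizers_eq`). Only the fitted vector matters, so the oracle coefficients need
not be unique.

The signal lies in the span of the columns in `S`, so the residual is that of the noise alone. As
the residual map is self-adjoint, the correlation with column `z` is a linear form in the noise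
whose coefficient vector, the residual of `z`, is no longer than `z`. Given the design it is
sub-Gaussian with parameter at most a constant times `‖z‖²`. A Chernoff bound gives `‖z‖² ≤ D * n`,
where `n` is the number of rows in which the column is active (`measureReal_correlation_ge_le`).
Correlations are thus of order `√(n log p)`, with `n = N` for `β` and `n = nS` for a contrast, which
are the two scales of `lam0` and `lam1`. A union bound over the `(K + 1) p` columns uses `log K ≤ M
log p`. -/

namespace AdaTrans

open MeasureTheory ProbabilityTheory Finset

/-! ### Deterministic weighted Lasso and least-squares residuals. -/

section Lasso

variable {J F : Type*} [NormedAddCommGroup F] [InnerProductSpace ℝ F]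

/-- The coefficient vectors that vanish outside `S`. -/
def supportedOn (S : Set J) : Submodule ℝ (J → ℝ) := Submodule.pi Sᶜ (fun _ => ⊥)

lemma mem_supportedOn {S : Set J} {c : J → ℝ} : c ∈ supportedOn S ↔ ∀ j ∉ S, c j = 0 := by
  simp [supportedOn, Submodule.mem_pi]

variable [Fintype J]

/-- The span of the columns `z j`, `j ∈ S`. -/
def columnSpan (z : J → F) (S : Set J) : Submodule ℝ F :=
  (supportedOn S).map (Fintype.linearCombination ℝ z)

lemma linearCombination_mem_columnSpan {z : J → F} {S : Set J} {c : J → ℝ}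
    (hc : c ∈ supportedOn S) : ∑ j, c j • z j ∈ columnSpan z S :=
  ⟨c, hc, by simp [Fintype.linearCombination_apply]⟩

/-- The residual of the least-squares regression of `v` on the columns `z j`, `j ∈ S`. -/
noncomputable def residual [FiniteDimensional ℝ F] (z : J → F) (S : Set J) (v : F) : F :=
  v - (columnSpan z S).starProjection v

variable [FiniteDimensional ℝ F]

lemma inner_residual_eq_zero (z : J → F) (S : Set J) (v : F) {u : F} (hu : u ∈ columnSpan z S) :
    inner ℝ (residual z S v) u = 0 :=
  (columnSpan z S).starProjection_inner_eq_zero v u hu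

lemma inner_residual_residual (z : J → F) (S : Set J) (u v : F) :
    inner ℝ (residual z S u) (residual z S v) = inner ℝ (residual z S u) v := by
  conv_lhs => rw [show residual z S v = v - (columnSpan z S).starProjection v from rfl]
  rw [inner_sub_right, inner_residual_eq_zero z S u (Submodule.starProjection_apply_mem _ _),
    sub_zero]

/-- Self-adjointness moves the projection from the noise to the column, leaving a linear form in the
noise with coefficients determined by the design. -/
lemma inner_residual_comm (z : J → F) (S : Set J) (u v : F) :
    inner ℝ u (residual z S v) = inner ℝ (residual z S u) v := by
  rw [← inner_residual_residual, real_inner_comm, ← inner_residual_residual, real_inner_comm]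

lemma norm_residual_le (z : J → F) (S : Set J) (v : F) : ‖residual z S v‖ ≤ ‖v‖ := by
  have h := inner_residual_residual z S v v
  rw [real_inner_self_eq_norm_sq] at h
  have h' := real_inner_le_norm (residual z S v) v
  rw [← h] at h'
  by_contra! hlt
  nlinarith [norm_nonneg v]

lemma residual_add (z : J → F) (S : Set J) (u v : F) :
    residual z S (u + v) = residual z S u + residual z S v := by
  simp only [residual, map_add]; abel

lemma residual_sub (z : J → F) (S : Set J) (u v : F) :
    residual z S (u - v) = residual z S u - residual z S v := by
  simp only [residual, map_sub]; abel

lemma residual_eq_zero (z : J → F) (S : Set J) {u : F} (hu : u ∈ columnSpan z S) :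
    residual z S u = 0 := by
  simp [residual, Submodule.starProjection_eq_self_iff.2 hu]

/-- The infimum runs over coefficients that do not depend on `z`. This gives measurability in the
columns, although the projection can jump where their rank drops. -/
lemma norm_residual_eq_iInf (z : J → F) (S : Set J) (v : F) :
    ‖residual z S v‖ = ⨅ c : supportedOn S, ‖v - ∑ j, (c : J → ℝ) j • z j‖ := by
  rw [residual, Submodule.starProjection_minimal]
  symm
  refine Function.Surjective.iInf_congr
    (fun c => ⟨_, linearCombination_mem_columnSpan c.2⟩) ?_ (fun _ => rfl)
  rintro ⟨_, c, hc, rfl⟩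
  exact ⟨⟨c, hc⟩, Subtype.ext (by simp [Fintype.linearCombination_apply])⟩

/-- Least squares on the columns in `S` decomposes around any solution `c₀`: the fit of `c₀` is the
orthogonal projection. -/
lemma norm_sub_sq_eq (z : J → F) (S : Set J) (y : F) {c₀ : J → ℝ}
    (h₀ : y - ∑ j, c₀ j • z j = residual z S y) (c : J → ℝ) :
    ‖y - ∑ j, c j • z j‖ ^ 2 = ‖residual z S y‖ ^ 2
      - 2 * ∑ j, (c j - c₀ j) * inner ℝ (z j) (residual z S y)
      + ‖∑ j, (c j - c₀ j) • z j‖ ^ 2 := by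
  have h : y - ∑ j, c j • z j = residual z S y - ∑ j, (c j - c₀ j) • z j := by
    simp only [← h₀, sub_smul, sum_sub_distrib]; abel
  rw [h, norm_sub_sq_real, inner_sum]
  simp only [inner_smul_right, real_inner_comm (residual z S y)]

lemma exists_fit_eq (z : J → F) (S : Set J) (y : F) :
    ∃ c ∈ supportedOn S, y - ∑ j, c j • z j = residual z S y := by
  obtain ⟨c, hc, h⟩ := Submodule.starProjection_apply_mem (columnSpan z S) y
  exact ⟨c, hc, by rw [residual, ← h, Fintype.linearCombination_apply]⟩

/-- If the penalty weights vanish on `S` and strictly dominate the correlations of the residual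
off `S`, the minimizers of the weighted Lasso are exactly the least-squares solutions supported
on `S`, and they exist. -/
theorem lasso_minimizers_eq (z : J → F) (S : Set J) (y : F) (W : J → ℝ) {s : ℝ} (hs : 0 < s)
    (hWS : ∀ j ∈ S, W j = 0)
    (hW : ∀ j ∉ S, 2 * s * |inner ℝ (z j) (residual z S y)| < W j) :
    {c : J → ℝ | ∀ c' : J → ℝ, s * ‖y - ∑ j, c j • z j‖ ^ 2 + ∑ j, W j * |c j| ≤
        s * ‖y - ∑ j, c' j • z j‖ ^ 2 + ∑ j, W j * |c' j|}.Nonempty ∧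
    {c : J → ℝ | ∀ c' : J → ℝ, s * ‖y - ∑ j, c j • z j‖ ^ 2 + ∑ j, W j * |c j| ≤
        s * ‖y - ∑ j, c' j • z j‖ ^ 2 + ∑ j, W j * |c' j|} =
    {c | c ∈ supportedOn S ∧ ∀ c' ∈ supportedOn S,
      s * ‖y - ∑ j, c j • z j‖ ^ 2 ≤ s * ‖y - ∑ j, c' j • z j‖ ^ 2} := by
  classical
  obtain ⟨c₀, hc₀, hfit⟩ := exists_fit_eq z S y
  set r := residual z S y
  have hpen : ∀ c ∈ supportedOn S, ∑ j, W j * |c j| = 0 := fun c hc =>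
    sum_eq_zero fun j _ => by
      by_cases hj : j ∈ S
      · rw [hWS j hj, zero_mul]
      · rw [mem_supportedOn.1 hc j hj, abs_zero, mul_zero]
  -- No coordinate gains more in fit than it pays in penalty: on `S` the weight and the correlation
  -- with `r` both vanish; off `S`, `c₀ j = 0` and the weight dominates.
  have hterm : ∀ c : J → ℝ, ∀ j,
      0 ≤ W j * |c j| - 2 * s * ((c j - c₀ j) * inner ℝ (z j) r) := fun c j => by
    by_cases hj : j ∈ S
    · have : inner ℝ (z j) r = 0 := by
        rw [real_inner_comm]
        refine inner_residual_eq_zero z S y ⟨Pi.single j 1, ?_, by simp⟩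
        exact mem_supportedOn.2 fun i hi =>
          Pi.single_eq_of_ne (fun h : i = j => hi (h ▸ hj)) _
      rw [hWS j hj, this]; simp
    · rw [mem_supportedOn.1 hc₀ j hj, sub_zero]
      have h1 := hW j hj
      have h2 := mul_le_mul_of_nonneg_right h1.le (abs_nonneg (c j))
      have h3 := le_abs_self (c j * inner ℝ (z j) r)
      rw [abs_mul] at h3
      nlinarith
  -- An exact identity: the oracle value plus two nonnegative terms.
  have hlow : ∀ c : J → ℝ, s * ‖y - ∑ j, c j • z j‖ ^ 2 + ∑ j, W j * |c j| =
      s * ‖r‖ ^ 2 + s * ‖∑ j, (c j - c₀ j) • z j‖ ^ 2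
        + ∑ j, (W j * |c j| - 2 * s * ((c j - c₀ j) * inner ℝ (z j) r)) := fun c => by
    rw [norm_sub_sq_eq z S y hfit c, sum_sub_distrib, ← mul_sum]; ring
  have hge : ∀ c : J → ℝ, s * ‖r‖ ^ 2 ≤
      s * ‖y - ∑ j, c j • z j‖ ^ 2 + ∑ j, W j * |c j| := fun c => by
    rw [hlow c]
    have := sum_nonneg fun j (_ : j ∈ univ) => hterm c j
    have : 0 ≤ s * ‖∑ j, (c j - c₀ j) • z j‖ ^ 2 := by positivity
    linarith
  -- At the minimal value every term of the sum must vanish; the strict inequality in `hW` then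
  -- forces `c j = 0` off `S`.
  have hmem : ∀ c : J → ℝ, s * ‖y - ∑ j, c j • z j‖ ^ 2 + ∑ j, W j * |c j| ≤ s * ‖r‖ ^ 2 →
      c ∈ supportedOn S := fun c hc => by
    rw [hlow c] at hc
    have h0 : 0 ≤ s * ‖∑ j, (c j - c₀ j) • z j‖ ^ 2 := by positivity
    refine mem_supportedOn.2 fun j hj => ?_
    have h1 := single_le_sum (fun j (_ : j ∈ univ) => hterm c j) (mem_univ j)
    rw [mem_supportedOn.1 hc₀ j hj, sub_zero] at h1
    have h2 := hW j hj
    have h3 := le_abs_self (c j * inner ℝ (z j) r)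
    rw [abs_mul] at h3
    by_contra hne
    have h4 := mul_lt_mul_of_pos_right h2 (abs_pos.2 hne)
    nlinarith
  have hval₀ : s * ‖y - ∑ j, c₀ j • z j‖ ^ 2 = s * ‖r‖ ^ 2 := by rw [hfit]
  refine ⟨⟨c₀, fun c' => ?_⟩, Set.ext fun c => ⟨fun h => ?_, fun h c' => ?_⟩⟩
  · rw [hpen c₀ hc₀, hval₀, add_zero]; exact hge c'
  · have hc := hmem c (by have := h c₀; rwa [hpen c₀ hc₀, hval₀, add_zero] at this)
    refine ⟨hc, fun c' hc' => ?_⟩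
    have := h c'
    rwa [hpen c hc, hpen c' hc', add_zero, add_zero] at this
  · have := h.2 c₀ hc₀
    rw [hpen c h.1, add_zero]
    rw [hval₀] at this
    exact this.trans (hge c')

/-! ### Joint measurability of residuals in columns and response. -/

variable [MeasurableSpace F] [BorelSpace F]

/-- An infimum of continuous functions is upper semicontinuous, even over an uncountable family. -/
lemma measurable_norm_residual (S : Set J) :
    Measurable fun q : (J → F) × F => ‖residual q.1 S q.2‖ := by
  simp only [norm_residual_eq_iInf]
  refine UpperSemicontinuous.measurable (upperSemicontinuous_ciInf
    (fun q => ⟨0, by rintro _ ⟨c, rfl⟩; positivity⟩) fun c => Continuous.upperSemicontinuous ?_)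
  fun_prop

/-- Polarisation recovers the inner product from norms of residuals. -/
lemma measurable_inner_residual (S : Set J) :
    Measurable fun q : (J → F) × F × F => inner ℝ (residual q.1 S q.2.1) q.2.2 := by
  have h : ∀ q : (J → F) × F × F, inner ℝ (residual q.1 S q.2.1) q.2.2 =
      (‖residual q.1 S (q.2.1 + q.2.2)‖ * ‖residual q.1 S (q.2.1 + q.2.2)‖ -
        ‖residual q.1 S (q.2.1 - q.2.2)‖ * ‖residual q.1 S (q.2.1 - q.2.2)‖) / 4 := fun q => by
    rw [← inner_residual_residual, residual_add, residual_sub, norm_add_mul_self_real,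
      norm_sub_mul_self_real]
    ring
  simp only [h]
  have := measurable_norm_residual (F := F) S
  have hadd : Measurable fun q : (J → F) × F × F => ‖residual q.1 S (q.2.1 + q.2.2)‖ :=
    this.comp (f := fun q : (J → F) × F × F => (q.1, q.2.1 + q.2.2)) (by fun_prop)
  have hsub : Measurable fun q : (J → F) × F × F => ‖residual q.1 S (q.2.1 - q.2.2)‖ :=
    this.comp (f := fun q : (J → F) × F × F => (q.1, q.2.1 - q.2.2)) (by fun_prop)
  exact ((hadd.mul hadd).sub (hsub.mul hsub)).div_const 4

end Lasso

/-! ### Sub-Gaussian tails, sums of squares and conditioning on an independent variable. -/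

section Concentration

variable {Ω O : Type*} [MeasurableSpace Ω] {μ : Measure Ω}

lemma HasSubgaussianMGF.mono {Y : Ω → ℝ} {c c' : NNReal} (h : HasSubgaussianMGF Y c μ)
    (hc : c ≤ c') : HasSubgaussianMGF Y c' μ where
  integrable_exp_mul := h.integrable_exp_mul
  mgf_le t := (h.mgf_le t).trans (Real.exp_le_exp.2 (by
    have : (c : ℝ) ≤ c' := hc
    gcongr))

lemma hasSubgaussianMGF_of_hasLaw_gaussianReal {Y : Ω → ℝ} {v : NNReal}
    (h : HasLaw Y (gaussianReal 0 v) μ) : HasSubgaussianMGF Y v μ where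
  integrable_exp_mul t := by
    have := integrable_exp_mul_gaussianReal (μ := 0) (v := v) t
    rw [← h.map_eq] at this
    exact this.comp_aemeasurable h.aemeasurable
  mgf_le t := by rw [mgf_gaussianReal h.map_eq]; simp

/-- The square of a sub-Gaussian variable has a finite exponential moment, with constants that
depend only on the sub-Gaussian parameter. -/
theorem exists_mgf_sq_le (κ : NNReal) : ∃ s > (0 : ℝ), ∃ B : ℝ, ∀ (Ω : Type*) [MeasurableSpace Ω]
    (μ : Measure Ω) [IsProbabilityMeasure μ] (Y : Ω → ℝ), Measurable Y → HasSubgaussianMGF Y κ μ →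
      Integrable (fun ω => Real.exp (s * Y ω ^ 2)) μ ∧
        mgf (fun ω => Y ω ^ 2) μ s ≤ Real.exp B := by
  obtain ⟨C, hC, hint⟩ := IsGaussian.exists_integrable_exp_sq (gaussianReal 0 1)
  set A := ∫ g, Real.exp (C * ‖g‖ ^ 2) ∂(gaussianReal 0 1) with hA
  have hApos : 0 < A := integral_exp_pos hint
  have hκ : (0 : ℝ) < κ + 1 := by positivity
  -- The choice ensures `κ * s ≤ C`; the `+ 1` covers `κ = 0`.
  refine ⟨C / (κ + 1), by positivity, Real.log A, ?_⟩
  intro Ω _ μ _ Y hY hsub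
  set s := C / ((κ : ℝ) + 1) with hs
  have hspos : 0 < s := by positivity
  have hκs : κ * s ≤ C := by
    rw [hs, mul_div_assoc', div_le_iff₀ hκ]; nlinarith
  -- Gaussian linearisation: `exp (s x²)` is the mean of `exp (√(2s) g x)` over a standard Gaussian
  -- `g`. After exchanging the integrals, the sub-Gaussian bound at `√(2s) g` leaves `exp (κ s g²) ≤
  -- exp (C g²)`, of mean at most `A`.
  have hinner : ∀ x : ℝ, ∫⁻ g, ENNReal.ofReal (Real.exp (Real.sqrt (2 * s) * g * x))
      ∂(gaussianReal 0 1) = ENNReal.ofReal (Real.exp (s * x ^ 2)) := fun x => by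
    have h1 : ∀ g : ℝ, Real.sqrt (2 * s) * g * x = (Real.sqrt (2 * s) * x) * g := fun g => by ring
    simp only [h1]
    rw [← ofReal_integral_eq_lintegral_ofReal (integrable_exp_mul_gaussianReal _)
      (ae_of_all _ fun _ => (Real.exp_pos _).le)]
    have := congrFun (mgf_id_gaussianReal (μ := 0) (v := 1)) (Real.sqrt (2 * s) * x)
    simp only [mgf, id] at this
    rw [this, mul_pow, Real.sq_sqrt (by positivity)]
    congr 2
    simp; ring
  have hlint : ∫⁻ ω, ENNReal.ofReal (Real.exp (s * Y ω ^ 2)) ∂μ ≤ ENNReal.ofReal A := by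
    simp only [← hinner]
    rw [lintegral_lintegral_swap (by fun_prop), hA,
      ofReal_integral_eq_lintegral_ofReal hint (ae_of_all _ fun _ => (Real.exp_pos _).le)]
    refine lintegral_mono fun g => ?_
    rw [← ofReal_integral_eq_lintegral_ofReal (hsub.integrable_exp_mul _)
      (ae_of_all _ fun _ => (Real.exp_pos _).le)]
    refine ENNReal.ofReal_le_ofReal ((hsub.mgf_le _).trans (Real.exp_le_exp.2 ?_))
    rw [mul_pow, Real.sq_sqrt (by positivity), Real.norm_eq_abs, sq_abs]
    nlinarith [mul_le_mul_of_nonneg_right hκs (sq_nonneg g)]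
  have hI : Integrable (fun ω => Real.exp (s * Y ω ^ 2)) μ := by
    refine ⟨by fun_prop, ?_⟩
    rw [hasFiniteIntegral_iff_ofReal (ae_of_all _ fun _ => (Real.exp_pos _).le)]
    exact hlint.trans_lt ENNReal.ofReal_lt_top
  refine ⟨hI, ?_⟩
  rw [Real.exp_log hApos, mgf]
  rw [← ofReal_integral_eq_lintegral_ofReal hI (ae_of_all _ fun _ => (Real.exp_pos _).le)] at hlint
  exact (ENNReal.ofReal_le_ofReal_iff hApos.le).1 hlint

/-- Chernoff bound for a sum of squares of independent variables. -/
lemma measureReal_sum_sq_ge_le [IsProbabilityMeasure μ] {Y : O → Ω → ℝ}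
    (hY : ∀ o, Measurable (Y o)) (hind : iIndepFun Y μ) {s B : ℝ} (hs : 0 < s)
    (hint : ∀ o, Integrable (fun ω => Real.exp (s * Y o ω ^ 2)) μ)
    (hmgf : ∀ o, mgf (fun ω => Y o ω ^ 2) μ s ≤ Real.exp B) (T : Finset O) (D : ℝ) :
    μ.real {ω | D * #T ≤ ∑ o ∈ T, Y o ω ^ 2} ≤ Real.exp (-((s * D - B) * #T)) := by
  have hind' : iIndepFun (fun o ω => Y o ω ^ 2) μ :=
    hind.comp (fun _ x => x ^ 2) fun _ => by fun_prop
  have hmeas : ∀ o, Measurable fun ω => Y o ω ^ 2 := fun o => (hY o).pow_const 2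
  have hsum : Integrable (fun ω => Real.exp (s * (∑ o ∈ T, fun ω => Y o ω ^ 2) ω)) μ :=
    hind'.integrable_exp_mul_sum hmeas fun o _ => hint o
  have h := measure_ge_le_exp_mul_mgf (D * #T) hs.le hsum
  simp only [Finset.sum_apply] at h
  refine h.trans ?_
  rw [hind'.mgf_sum hmeas]
  calc Real.exp (-s * (D * #T)) * ∏ o ∈ T, mgf (fun ω => Y o ω ^ 2) μ s
      ≤ Real.exp (-s * (D * #T)) * ∏ _o ∈ T, Real.exp B := by
        gcongr with o ho
        · exact fun _ _ => mgf_nonneg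
        · exact hmgf o
    _ = _ := by
        rw [prod_const, ← Real.exp_nat_mul, ← Real.exp_add]
        congr 1; ring

/-- Two-sided tail of a linear form in independent sub-Gaussian variables. -/
lemma measureReal_abs_sum_ge_le [Fintype O] [IsProbabilityMeasure μ] {e : O → Ω → ℝ}
    (hind : iIndepFun e μ) {c : NNReal} (hsub : ∀ o, HasSubgaussianMGF (e o) c μ)
    (u : O → ℝ) {D t : ℝ} (hu : ∑ o, u o ^ 2 ≤ D) (ht : 0 ≤ t) :
    μ.real {ω | t ≤ |∑ o, u o * e o ω|} ≤ 2 * Real.exp (-t ^ 2 / (2 * (c * D))) := by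
  have hD : 0 ≤ D := (sum_nonneg fun o _ => sq_nonneg (u o)).trans hu
  have hind' : iIndepFun (fun o ω => u o * e o ω) μ :=
    hind.comp (fun o x => u o * x) fun _ => by fun_prop
  have hS := HasSubgaussianMGF.sum_of_iIndepFun hind' (s := univ)
    fun o _ => (hsub o).const_mul (u o)
  have hS' : HasSubgaussianMGF (fun ω => ∑ o, u o * e o ω) (c * D.toNNReal) μ := by
    refine HasSubgaussianMGF.mono hS ?_
    rw [← NNReal.coe_le_coe]
    push_cast
    rw [Real.coe_toNNReal _ hD]
    change ∑ o, u o ^ 2 * (c : ℝ) ≤ c * D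
    rw [← sum_mul, mul_comm]
    exact mul_le_mul_of_nonneg_left hu c.2
  have h1 := hS'.measure_ge_le ht
  have h2 := hS'.neg.measure_ge_le ht
  have hcoe : ((c * D.toNNReal : NNReal) : ℝ) = c * D := by
    push_cast; rw [Real.coe_toNNReal _ hD]
  rw [hcoe] at h1 h2
  calc μ.real {ω | t ≤ |∑ o, u o * e o ω|}
      ≤ μ.real ({ω | t ≤ ∑ o, u o * e o ω} ∪ {ω | t ≤ (-fun ω => ∑ o, u o * e o ω) ω}) := by
        refine measureReal_mono fun ω hω => ?_
        simpa [le_abs] using hω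
    _ ≤ _ := (measureReal_union_le _ _).trans (by linarith)

/-- A bound on all sections of a measurable set bounds its probability under an independent
pair. -/
lemma measureReal_prodMk_le_of_indepFun {α β : Type*} [MeasurableSpace α] [MeasurableSpace β]
    [IsProbabilityMeasure μ] {f : Ω → α} {g : Ω → β} (hf : Measurable f) (hg : Measurable g)
    (hfg : IndepFun f g μ) {A : Set (α × β)} (hA : MeasurableSet A) {b : ℝ} (hb : 0 ≤ b)
    (h : ∀ x, μ.real {ω | (f ω, x) ∈ A} ≤ b) : μ.real {ω | (f ω, g ω) ∈ A} ≤ b := by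
  have := Measure.isProbabilityMeasure_map (μ := μ) hf.aemeasurable
  have := Measure.isProbabilityMeasure_map (μ := μ) hg.aemeasurable
  refine ENNReal.toReal_le_of_le_ofReal hb ?_
  change μ ((fun ω => (f ω, g ω)) ⁻¹' A) ≤ _
  rw [← Measure.map_apply (hf.prodMk hg) hA,
    (indepFun_iff_map_prod_eq_prod_map_map hf.aemeasurable hg.aemeasurable).1 hfg,
    Measure.prod_apply_symm hA]
  calc ∫⁻ x, (μ.map f) ((fun e => (e, x)) ⁻¹' A) ∂(μ.map g)
      ≤ ∫⁻ _, ENNReal.ofReal b ∂(μ.map g) := by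
        refine lintegral_mono fun x => ?_
        rw [Measure.map_apply hf (measurable_prodMk_right hA)]
        exact (ENNReal.le_ofReal_iff_toReal_le (measure_ne_top _ _) hb).2 (h x)
    _ = ENNReal.ofReal b := by simp

end Concentration

/-! ### The fused problem as a single regression, and the penalty weights. -/

section Stacked

variable {K nT nS p : ℕ}

/-- The index set of all coefficients: `p` entries of `β` and `p` entries of each contrast. -/
abbrev Coef (K p : ℕ) : Type := Fin p ⊕ (Fin K × Fin p)

/-- The parameters as a single coefficient vector. -/
def stack : (Fin p → ℝ) × (Fin K → Fin p → ℝ) ≃ (Coef K p → ℝ) where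
  toFun θ := Sum.elim θ.1 fun q => θ.2 q.1 q.2
  invFun c := (fun j => c (.inl j), fun k j => c (.inr (k, j)))
  left_inv _ := rfl
  right_inv c := by ext (_ | _) <;> rfl

@[simp]
lemma stack_inl (θ : (Fin p → ℝ) × (Fin K → Fin p → ℝ)) (j : Fin p) :
    stack θ (.inl j) = θ.1 j := rfl

@[simp]
lemma stack_inr (θ : (Fin p → ℝ) × (Fin K → Fin p → ℝ)) (q : Fin K × Fin p) :
    stack θ (.inr q) = θ.2 q.1 q.2 := rfl

/-- The observations in which a coefficient is active. -/
def activeRows (nT nS : ℕ) : Coef K p → Finset (Obs K nT nS) :=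
  Sum.elim (fun _ => univ) fun q => univ.filter fun o => o.1 = q.1.succ

/-- The covariate that a coefficient multiplies. -/
def covariate : Coef K p → Fin p := Sum.elim id Prod.snd

/-- The columns of the stacked design matrix. -/
noncomputable def column (x : Obs K nT nS → Fin p → ℝ) (j : Coef K p) :
    EuclideanSpace ℝ (Obs K nT nS) :=
  WithLp.toLp 2 fun o => if o ∈ activeRows nT nS j then x o (covariate j) else 0

/-- A row of task `0` meets only the `β` columns; a row of a source task also meets the columns of
its own contrast. -/
lemma sum_stack_smul_column (x : Obs K nT nS → Fin p → ℝ)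
    (θ : (Fin p → ℝ) × (Fin K → Fin p → ℝ)) :
    ∑ j, stack θ j • column x j = WithLp.toLp 2 fun o => x o ⬝ᵥ (θ.1 + extend θ.2 o.1) := by
  ext o
  obtain ⟨k, i⟩ := o
  simp only [WithLp.ofLp_sum, WithLp.ofLp_smul, Finset.sum_apply, Pi.smul_apply, smul_eq_mul]
  simp only [Fintype.sum_sum_type, Fintype.sum_prod_type, column, stack_inl, stack_inr,
    activeRows, covariate, Sum.elim_inl, Sum.elim_inr, mem_univ, if_true, id, mem_filter, true_and,
    dotProduct, Pi.add_apply, mul_add, sum_add_distrib]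
  congr 1
  · exact sum_congr rfl fun _ _ => mul_comm _ _
  · revert i
    refine Fin.cases (fun i => ?_) (fun k i => ?_) k
    · simp [extend, (Fin.succ_ne_zero _).symm]
    · simp only [extend, Fin.cons_succ, Fin.succ_inj, mul_ite, mul_zero]
      rw [sum_eq_single k (fun l _ hl => by simp [hl.symm]) (by simp)]
      simp [mul_comm]

lemma loss_eq (x : Obs K nT nS → Fin p → ℝ) (y : Obs K nT nS → ℝ)
    (θ : (Fin p → ℝ) × (Fin K → Fin p → ℝ)) :
    loss x y θ = 1 / (totalSize K nT nS : ℝ) *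
      ‖WithLp.toLp 2 y - ∑ j, stack θ j • column x j‖ ^ 2 := by
  rw [sum_stack_smul_column, EuclideanSpace.norm_sq_eq, Fintype.sum_sigma, loss]
  simp

lemma mem_oracleFeasible_iff {β : Fin p → ℝ} {δ : Fin K → Fin p → ℝ}
    {θ : (Fin p → ℝ) × (Fin K → Fin p → ℝ)} :
    θ ∈ oracleFeasible β δ ↔ stack θ ∈ supportedOn {j | stack (β, δ) j ≠ 0} := by
  simp [oracleFeasible, mem_supportedOn]

lemma norm_column_sq (x : Obs K nT nS → Fin p → ℝ) (j : Coef K p) :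
    ‖column x j‖ ^ 2 = ∑ o ∈ activeRows nT nS j, x o (covariate j) ^ 2 := by
  simp [EuclideanSpace.norm_sq_eq, column]

/-- The two row counts, `N` here and `nS` for contrasts, set the different scales of `lam0` and
`lam1`. -/
lemma card_activeRows_inl (j : Fin p) :
    #(activeRows nT nS (.inl j : Coef K p)) = totalSize K nT nS := by
  simp only [activeRows, Sum.elim_inl, card_univ, Fintype.card_sigma, Fintype.card_fin]
  simp [totalSize, taskSize, Fin.sum_univ_succ, add_comm]

lemma card_activeRows_inr (q : Fin K × Fin p) :
    #(activeRows nT nS (.inr q : Coef K p)) = nS := by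
  have : (univ.filter fun o : Obs K nT nS => o.1 = q.1.succ) =
      univ.map ⟨fun i : Fin (taskSize K nT nS q.1.succ) => (⟨q.1.succ, i⟩ : Obs K nT nS),
        fun _ _ h => by simpa using h⟩ := by
    ext ⟨k, i⟩
    simp only [mem_filter, mem_univ, true_and, mem_map]
    constructor
    · rintro rfl; exact ⟨i, rfl⟩
    · rintro ⟨i', h⟩; exact (congrArg Sigma.fst h).symm
  simp only [activeRows, Sum.elim_inr, this, card_map, card_univ, Fintype.card_fin]
  simp [taskSize]

lemma measurable_column :
    Measurable fun x : Obs K nT nS → Fin p → ℝ => (column x : Coef K p → _) := by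
  refine measurable_pi_lambda _ fun j => (WithLp.measurable_toLp 2 _).comp ?_
  refine measurable_pi_lambda _ fun o => ?_
  split_ifs <;> fun_prop

/-- The signal lies in the span of the columns in the true support, so the regression removes it. -/
lemma residual_response (x : Obs K nT nS → Fin p → ℝ) (e : Obs K nT nS → ℝ)
    (β : Fin p → ℝ) (δ : Fin K → Fin p → ℝ) :
    residual (column x) {j | stack (β, δ) j ≠ 0} (WithLp.toLp 2 (response x e β δ)) =
      residual (column x) {j | stack (β, δ) j ≠ 0} (WithLp.toLp 2 e) := by
  have h : WithLp.toLp 2 (response x e β δ) =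
      ∑ j, stack (β, δ) j • column x j + WithLp.toLp 2 e := by
    rw [sum_stack_smul_column]; rfl
  rw [h, residual_add, residual_eq_zero, zero_add]
  exact linearCombination_mem_columnSpan (mem_supportedOn.2 fun j hj => by simpa using hj)

/-- Since `a₂ < a`, `|x| ≥ (3a/2 - a₂/2) * lam > a * lam`, where the penalty is flat. -/
lemma weight_eq_zero {R : ℝ → ℝ → ℝ} {a a₁ a₂ : ℝ} (hR : IsFoldedConcave R a a₁ a₂)
    (ha : a₂ < a) {lam : ℝ} (hlam : 0 < lam) {x b : ℝ} (hb : 3 * a / 2 * lam ≤ |b|)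
    (hx : |x - b| ≤ a₂ / 2 * lam) : weight R lam x = 0 := by
  rw [weight, hR.deriv_eq_zero lam hlam, mul_zero]
  have h := abs_sub_abs_le_abs_sub b x
  rw [abs_sub_comm b x] at h
  nlinarith

/-- The estimate of a zero coordinate stays in `[0, a₂ * lam]` in absolute value, where the penalty
slope is at least `a₁ * lam`. -/
lemma le_weight {R : ℝ → ℝ → ℝ} {a a₁ a₂ : ℝ} (hR : IsFoldedConcave R a a₁ a₂)
    (ha₂ : 0 ≤ a₂) {lam : ℝ} (hlam : 0 < lam) {x : ℝ} (hx : |x| ≤ a₂ / 2 * lam) :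
    a₁ * lam ≤ lam * weight R lam x := by
  rw [weight, ← mul_assoc, mul_inv_cancel₀ hlam.ne', one_mul]
  exact hR.deriv_ge lam hlam _ (abs_nonneg x) (by nlinarith [mul_nonneg ha₂ hlam.le])

/-- On the event that the residual correlations are small off the true supports, accurate initial
values make the weighted fused Lasso equivalent to the oracle problem. -/
theorem lassoSolutions_eq_oracleSolutions {a a₁ a₂ : ℝ} (ha₂ : 0 ≤ a₂) (ha : a₂ < a)
    (hN : 0 < totalSize K nT nS) {lam0 lam1 : ℝ} (hlam0 : 0 < lam0) (hlam1 : 0 < lam1)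
    {h0 : ℝ} {h : Fin K → ℝ} (hh0 : 3 * a / 2 * lam0 ≤ h0) (hh : ∀ k, 3 * a / 2 * lam1 ≤ h k)
    {β : Fin p → ℝ} {δ : Fin K → Fin p → ℝ} (hθ : (β, δ) ∈ Theta1 h0 h)
    {R : ℝ → ℝ → ℝ} (hR : IsFoldedConcave R a a₁ a₂)
    {b : Fin p → ℝ} {d : Fin K → Fin p → ℝ} (hacc : Accurate a₂ lam0 lam1 β δ b d)
    {x : Obs K nT nS → Fin p → ℝ} {e : Obs K nT nS → ℝ}
    (hcorr : ∀ j : Coef K p,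
      |inner ℝ (residual (column x) {j | stack (β, δ) j ≠ 0} (column x j)) (WithLp.toLp 2 e)| <
        totalSize K nT nS / 2 * (a₁ * Sum.elim (fun _ => lam0) (fun _ => lam1) j)) :
    (lassoSolutions x (response x e β δ) lam0 lam1 (fun j => weight R lam0 (b j))
      (fun k j => weight R lam1 (d k j))).Nonempty ∧
    lassoSolutions x (response x e β δ) lam0 lam1 (fun j => weight R lam0 (b j))
      (fun k j => weight R lam1 (d k j)) = oracleSolutions x (response x e β δ) β δ := by
  have hN' : (0 : ℝ) < totalSize K nT nS := by exact_mod_cast hN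
  set y := response x e β δ with hy
  set S : Set (Coef K p) := {j | stack (β, δ) j ≠ 0} with hS
  have hb : ∀ j, |b j - β j| ≤ a₂ / 2 * lam0 := fun j => (norm_le_pi_norm (b - β) j).trans hacc.1
  have hd : ∀ k j, |d k j - δ k j| ≤ a₂ / 2 * lam1 := fun k j =>
    (norm_le_pi_norm (d k - δ k) j).trans (hacc.2 k)
  set W : Coef K p → ℝ := Sum.elim (fun j => lam0 * weight R lam0 (b j))
    fun q => lam1 * weight R lam1 (d q.1 q.2)
  have hobj : ∀ θ, objective x y lam0 lam1 (fun j => weight R lam0 (b j))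
      (fun k j => weight R lam1 (d k j)) θ = 1 / (totalSize K nT nS : ℝ) *
        ‖WithLp.toLp 2 y - ∑ j, stack θ j • column x j‖ ^ 2 + ∑ j, W j * |stack θ j| := fun θ => by
    rw [objective, loss_eq, add_assoc]
    congr 1
    simp only [W, Fintype.sum_sum_type, Fintype.sum_prod_type, stack_inl, stack_inr, Sum.elim_inl,
      Sum.elim_inr, mul_sum, mul_assoc]
  have hWS : ∀ j ∈ S, W j = 0 := by
    rintro (j | ⟨k, j⟩) hj
    · simp only [W, Sum.elim_inl]
      rw [weight_eq_zero hR ha hlam0 (hh0.trans (hθ.1 j hj)) (hb j), mul_zero]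
    · simp only [W, Sum.elim_inr]
      rw [weight_eq_zero hR ha hlam1 ((hh k).trans (hθ.2 k j hj)) (hd k j), mul_zero]
  have hlow : ∀ j ∉ S, a₁ * Sum.elim (fun _ => lam0) (fun _ => lam1) j ≤ W j := by
    rintro (j | ⟨k, j⟩) hj
    · have hz : β j = 0 := by simpa [S] using hj
      exact le_weight hR ha₂ hlam0 (by simpa [hz] using hb j)
    · have hz : δ k j = 0 := by simpa [S] using hj
      exact le_weight hR ha₂ hlam1 (by simpa [hz] using hd k j)
  have hmain := lasso_minimizers_eq (column x) S (WithLp.toLp 2 y) W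
    (one_div_pos.2 hN') hWS fun j hj => by
      -- The response is replaced by the noise, and the projection is moved onto the column, to
      -- match `hcorr`.
      rw [hy, hS, residual_response, inner_residual_comm]
      refine lt_of_lt_of_le ?_ (hlow j hj)
      calc 2 * (1 / (totalSize K nT nS : ℝ)) * _
          < 2 * (1 / (totalSize K nT nS : ℝ)) * _ :=
            mul_lt_mul_of_pos_left (hcorr j) (by positivity)
        _ = _ := by field_simp
  obtain ⟨⟨c, hc⟩, heq⟩ := hmain
  refine ⟨⟨stack.symm c, fun θ' => ?_⟩, Set.ext fun θ => ?_⟩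
  · rw [hobj, hobj, Equiv.apply_symm_apply]
    exact hc _
  · have := Set.ext_iff.1 heq (stack θ)
    simp only [Set.mem_ofPred_eq] at this
    simp only [lassoSolutions, oracleSolutions, Set.mem_ofPred_eq, hobj, mem_oracleFeasible_iff,
      loss_eq]
    exact (stack.surjective.forall.symm.trans this).trans
      (and_congr_right fun _ => stack.surjective.forall)

end Stacked

/-! ### Probability that a residual correlation is large. -/

section Event

variable {Ω : Type*} [MeasurableSpace Ω] {μ : Measure Ω} {K nT nS p : ℕ}
  {X : Obs K nT nS → Ω → Fin p → ℝ} {eps : Obs K nT nS → Ω → ℝ}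

lemma hasSubgaussianMGF_apply {V : Ω → Fin p → ℝ} {κ : NNReal} (h : IsSubGaussianVector V κ μ)
    (j : Fin p) : HasSubgaussianMGF (fun ω => V ω j) κ μ := by
  have := h (Pi.single j 1) (by simp [Pi.single_apply, ite_pow])
  simpa using this

/-- The correlation of column `j` with the noise, after both are regressed on the columns
in `S`. -/
noncomputable def correlation (S : Set (Coef K p)) (j : Coef K p) (e : Obs K nT nS → ℝ)
    (x : Obs K nT nS → Fin p → ℝ) : ℝ :=
  inner ℝ (residual (column x) S (column x j)) (WithLp.toLp 2 e)

lemma measurable_correlation (S : Set (Coef K p)) (j : Coef K p) :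
    Measurable fun q : (Obs K nT nS → ℝ) × (Obs K nT nS → Fin p → ℝ) =>
      correlation S j q.1 q.2 := by
  have hc : Measurable fun q : (Obs K nT nS → ℝ) × (Obs K nT nS → Fin p → ℝ) =>
      (column q.2 : Coef K p → _) := measurable_column.comp measurable_snd
  exact (measurable_inner_residual S).comp
    (hc.prodMk (((measurable_pi_apply j).comp hc).prodMk
      ((WithLp.measurable_toLp 2 _).comp measurable_fst)))

/-- Tail of the correlation of one column with the noise. -/
lemma measureReal_correlation_ge_le [IsProbabilityMeasure μ]
    (hXm : ∀ o, Measurable (X o)) (hXi : iIndepFun X μ)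
    (hem : ∀ o, Measurable (eps o)) (hei : iIndepFun eps μ)
    (heX : IndepFun (fun ω o => eps o ω) (fun ω o => X o ω) μ)
    {s B : ℝ} (hs : 0 < s)
    (hint : ∀ o j, Integrable (fun ω => Real.exp (s * X o ω j ^ 2)) μ)
    (hmgf : ∀ o j, mgf (fun ω => X o ω j ^ 2) μ s ≤ Real.exp B)
    {c : NNReal} (hsub : ∀ o, HasSubgaussianMGF (eps o) c μ)
    (S : Set (Coef K p)) (j : Coef K p) (D : ℝ) {t : ℝ} (ht : 0 ≤ t) :
    μ.real {ω | t ≤ |correlation S j (fun o => eps o ω) (fun o => X o ω)|} ≤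
      Real.exp (-((s * D - B) * #(activeRows nT nS j))) +
        2 * Real.exp (-t ^ 2 / (2 * (c * (D * #(activeRows nT nS j))))) := by
  set n : ℝ := (#(activeRows nT nS j) : ℝ)
  -- With the column bound included in `A`, the section at a fixed design is either empty or
  -- contained in the tail event of a fixed linear form in the noise.
  set A : Set ((Obs K nT nS → ℝ) × (Obs K nT nS → Fin p → ℝ)) :=
    {q | t ≤ |correlation S j q.1 q.2| ∧ ‖column q.2 j‖ ^ 2 ≤ D * n} with hA
  have hAm : MeasurableSet A := by
    have hc : Measurable fun q : (Obs K nT nS → ℝ) × (Obs K nT nS → Fin p → ℝ) =>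
        ‖column q.2 j‖ ^ 2 :=
      (((measurable_pi_apply j).comp (measurable_column.comp measurable_snd)).norm).pow_const 2
    exact (measurableSet_le measurable_const (measurable_correlation S j).abs).inter
      (measurableSet_le hc measurable_const)
  have hnoise : μ.real {ω | ((fun o => eps o ω), (fun o => X o ω)) ∈ A} ≤
      2 * Real.exp (-t ^ 2 / (2 * (c * (D * n)))) := by
    refine measureReal_prodMk_le_of_indepFun (measurable_pi_lambda _ hem)
      (measurable_pi_lambda _ hXm) heX hAm (by positivity) fun x => ?_
    by_cases hx : ‖column x j‖ ^ 2 ≤ D * n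
    · set u := residual (column x) S (column x j) with hu
      have hu2 : ∑ o, u o ^ 2 ≤ D * n := by
        have h1 : ‖u‖ ^ 2 ≤ ‖column x j‖ ^ 2 := by
          gcongr; exact norm_residual_le _ _ _
        rw [EuclideanSpace.norm_sq_eq] at h1
        simpa using h1.trans hx
      refine (measureReal_mono ?_).trans (measureReal_abs_sum_ge_le hei hsub (fun o => u o) hu2 ht)
      rintro ω ⟨hω, -⟩
      simpa [correlation, PiLp.inner_apply, ← hu, mul_comm] using hω
    · have : {ω | ((fun o => eps o ω), x) ∈ A} = ∅ :=
        Set.eq_empty_of_forall_notMem fun ω hω => hx hω.2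
      rw [this, measureReal_empty]; positivity
  have hdesign : μ.real {ω | D * n ≤ ∑ o ∈ activeRows nT nS j, X o ω (covariate j) ^ 2} ≤
      Real.exp (-((s * D - B) * n)) :=
    measureReal_sum_sq_ge_le (Y := fun o ω => X o ω (covariate j))
      (fun o => (measurable_pi_apply _).comp (hXm o))
      (hXi.comp (fun _ x => x (covariate j)) fun _ => measurable_pi_apply _) hs
      (fun o => hint o _) (fun o => hmgf o _) _ D
  refine (measureReal_mono ?_).trans ((measureReal_union_le _ _).trans (add_le_add hdesign hnoise))
  intro ω hω
  rcases le_total (D * n) (∑ o ∈ activeRows nT nS j, X o ω (covariate j) ^ 2) with h | h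
  · exact Or.inl h
  · exact Or.inr ⟨hω, by rw [norm_column_sq]; exact h⟩

/-- Numerical form of the tail bound: with `n ≥ c_n ℓ` active rows and a threshold of order
`√(n ℓ)`, both terms are at most of order `exp (-m ℓ)`. -/
lemma exp_add_exp_le {s B c D m c_n n ℓ t : ℝ} (hc : 0 < c) (hD : 0 < D) (hm : 0 < m)
    (hc_n : 0 < c_n) (hℓ : 0 < ℓ) (hn : c_n * ℓ ≤ n) (hsD : m / c_n ≤ s * D - B)
    (ht : 2 * c * D * m * (n * ℓ) ≤ t ^ 2) :
    Real.exp (-((s * D - B) * n)) + 2 * Real.exp (-t ^ 2 / (2 * (c * (D * n)))) ≤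
      3 * Real.exp (-(m * ℓ)) := by
  have hn0 : 0 < n := (mul_pos hc_n hℓ).trans_le hn
  have h1 : m * ℓ ≤ (s * D - B) * n := by
    calc m * ℓ = m / c_n * (c_n * ℓ) := by field_simp
      _ ≤ (s * D - B) * n := by
        have : 0 < m / c_n := by positivity
        gcongr
        linarith
  have h2 : -t ^ 2 / (2 * (c * (D * n))) ≤ -(m * ℓ) := by
    rw [div_le_iff₀ (by positivity)]
    nlinarith
  have h3 := Real.exp_le_exp.2 (neg_le_neg h1)
  have h4 := Real.exp_le_exp.2 h2
  linarith

end Event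

end AdaTrans

/-! ### Choice of constants and union bound. -/

open AdaTrans MeasureTheory ProbabilityTheory Finset

theorem theorem2
    (c_X : ℝ) (hc_X : 0 < c_X) (κ : NNReal) (c_eps : ℝ) (c_n : ℝ) (hc_n : 0 < c_n) (M : ℝ)
    (a a₁ a₂ : ℝ) (ha₁ : 0 < a₁) (ha₂ : 0 ≤ a₂) (ha : a₂ < a) :
    ∃ C₀ > (0 : ℝ), ∃ C₁ > (0 : ℝ), ∃ c₁ > (0 : ℝ),
      ∀ (K nT nS p : ℕ), 1 ≤ K →
        Real.log K ≤ M * Real.log p →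
        c_n * Real.log p ≤ nS →
      ∀ (Ω : Type*) [MeasurableSpace Ω] (μ : MeasureTheory.Measure Ω)
        [MeasureTheory.IsProbabilityMeasure μ]
        (X : AdaTrans.Obs K nT nS → Ω → Fin p → ℝ) (eps : AdaTrans.Obs K nT nS → Ω → ℝ)
        (Sig : Fin (K + 1) → Matrix (Fin p) (Fin p) ℝ) (v : Fin (K + 1) → NNReal),
        AdaTrans.DesignAssumption μ X Sig κ c_X →
        AdaTrans.NoiseAssumption μ X eps v c_eps →
      ∀ (lam0 lam1 : ℝ), 0 < lam0 → 0 < lam1 →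
        C₀ * Real.sqrt (Real.log p / AdaTrans.totalSize K nT nS) ≤ lam0 →
        C₁ * ((nS : ℝ) / AdaTrans.totalSize K nT nS * Real.sqrt (Real.log p / nS)) ≤ lam1 →
      ∀ (h0 : ℝ) (h : Fin K → ℝ),
        3 * a / 2 * lam0 ≤ h0 → (∀ k, 3 * a / 2 * lam1 ≤ h k) →
      ∀ (β : Fin p → ℝ) (δ : Fin K → Fin p → ℝ), (β, δ) ∈ AdaTrans.Theta1 h0 h →
      ∀ R : ℝ → ℝ → ℝ, AdaTrans.IsFoldedConcave R a a₁ a₂ →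
      ∀ (b_init : Ω → Fin p → ℝ) (d_init : Ω → Fin K → Fin p → ℝ),
      ∃ E : Set Ω, MeasurableSet E ∧ 1 - Real.exp (-c₁ * Real.log p) ≤ μ.real E ∧
        ∀ ω ∈ E, AdaTrans.Accurate a₂ lam0 lam1 β δ (b_init ω) (d_init ω) →
          let x := fun o => X o ω
          let y := AdaTrans.response x (fun o => eps o ω) β δ
          let S := AdaTrans.lassoSolutions x y lam0 lam1
            (fun j => AdaTrans.weight R lam0 (b_init ω j))
            (fun k j => AdaTrans.weight R lam1 (d_init ω k j))
          S.Nonempty ∧ S = AdaTrans.oracleSolutions x y β δ := by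
  obtain ⟨s, hs, B, hsq⟩ := exists_mgf_sq_le κ
  -- The `+ 1` keeps the variance proxy positive for every `c_eps`.
  set c : NNReal := c_eps.toNNReal + 1 with hc
  have hc0 : (0 : ℝ) < c := by positivity
  -- The exponent budget in units of `log p`: `|M|` pays for `K`, one for `p`, three for the
  -- numerical factor `6 ≤ p ^ 3`, and one remains as `c₁`.
  set m : ℝ := |M| + 5 with hm
  have hm0 : 0 < m := by positivity
  -- Makes the Chernoff exponent per row at least `m / c_n`, so that `c_n * log p` rows give `m *
  -- log p`.
  set D : ℝ := (|B| + m / c_n) / s with hD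
  have hD0 : 0 < D := by positivity
  have hsD : m / c_n ≤ s * D - B := by
    rw [hD, mul_div_cancel₀ _ hs.ne']
    linarith [le_abs_self B]
  -- At the threshold `L * √(n log p)` the noise tail has exponent exactly `m * log p`.
  set L : ℝ := Real.sqrt (2 * c * D * m) with hL
  have hL0 : 0 < L := by positivity
  have hLsq : L ^ 2 = 2 * c * D * m := Real.sq_sqrt (by positivity)
  -- The factor `2 / a₁` cancels `a₁ / 2` in the threshold `N / 2 * (a₁ * lam)`.
  refine ⟨2 * L / a₁, by positivity, 2 * L / a₁, by positivity, 1, one_pos, ?_⟩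
  intro K nT nS p hK hKp hnS Ω _ μ _ X eps Sig v hX heps lam0 lam1 hlam0 hlam1 hC0 hC1 h0 h hh0 hh
    β δ hθ R hR b_init d_init
  -- For `p ≤ 1`, `Real.log p = 0` (also at `p = 0`, by convention), so the required probability is
  -- `0` and the empty event suffices.
  rcases lt_or_ge p 2 with hp | hp
  · refine ⟨∅, MeasurableSet.empty, ?_, fun ω hω => hω.elim⟩
    have : Real.log p = 0 := by interval_cases p <;> simp
    simp [this]
  set ℓ := Real.log p with hℓ
  have hp' : (2 : ℝ) ≤ p := by exact_mod_cast hp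
  have hℓ0 : 0 < ℓ := Real.log_pos (by linarith)
  have hnS0 : (0 : ℝ) < nS := (mul_pos hc_n hℓ0).trans_le hnS
  have hnSN : (nS : ℝ) ≤ totalSize K nT nS := by
    rw [totalSize]
    exact_mod_cast (Nat.le_mul_of_pos_left nS hK).trans (Nat.le_add_right _ _)
  set N : ℝ := (totalSize K nT nS : ℝ) with hN
  have hN0 : 0 < N := hnS0.trans_le hnSN
  set S : Set (Coef K p) := {j | stack (β, δ) j ≠ 0} with hS
  set t : Coef K p → ℝ :=
    fun j => N / 2 * (a₁ * Sum.elim (fun _ => lam0) (fun _ => lam1) j)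
  have ht0 : ∀ j, 0 ≤ t j := by rintro (j | j) <;> simp only [t, Sum.elim_inl, Sum.elim_inr] <;>
    positivity
  set bad : Coef K p → Set Ω :=
    fun j => {ω | t j ≤ |correlation S j (fun o => eps o ω) (fun o => X o ω)|}
  have hjoint : Measurable fun ω => ((fun o => eps o ω), (fun o => X o ω)) :=
    (measurable_pi_lambda _ heps.measurable).prodMk (measurable_pi_lambda _ hX.measurable)
  have hbadm : ∀ j, MeasurableSet (bad j) := fun j =>
    measurableSet_le measurable_const ((measurable_correlation S j).comp hjoint).abs
  have hrows : ∀ j : Coef K p, c_n * ℓ ≤ #(activeRows nT nS j) ∧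
      2 * c * D * m * (#(activeRows nT nS j) * ℓ) ≤ t j ^ 2 := by
    rintro (j | q)
    · rw [card_activeRows_inl, ← hN]
      refine ⟨hnS.trans hnSN, ?_⟩
      -- Here `N * √(ℓ / N) = √(N ℓ)`; for a contrast the factor `nS / N` in the bound on `lam1`
      -- yields `√(nS ℓ)` in the same way.
      have h1 : L * (N * Real.sqrt (ℓ / N)) ≤ t (.inl j) := by
        simp only [t, Sum.elim_inl]
        calc L * (N * Real.sqrt (ℓ / N))
            = N / 2 * (a₁ * (2 * L / a₁ * Real.sqrt (ℓ / N))) := by field_simp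
          _ ≤ _ := by gcongr
      calc 2 * c * D * m * (N * ℓ) = (L * (N * Real.sqrt (ℓ / N))) ^ 2 := by
            rw [mul_pow, mul_pow, hLsq, Real.sq_sqrt (by positivity)]; field_simp
        _ ≤ _ := by gcongr
    · rw [card_activeRows_inr]
      refine ⟨hnS, ?_⟩
      have h1 : L * (nS * Real.sqrt (ℓ / nS)) ≤ t (.inr q) := by
        simp only [t, Sum.elim_inr]
        calc L * (nS * Real.sqrt (ℓ / nS))
            = N / 2 * (a₁ * (2 * L / a₁ * (nS / N * Real.sqrt (ℓ / nS)))) := by field_simp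
          _ ≤ _ := by gcongr
      calc 2 * c * D * m * (nS * ℓ) = (L * (nS * Real.sqrt (ℓ / nS))) ^ 2 := by
            rw [mul_pow, mul_pow, hLsq, Real.sq_sqrt (by positivity)]; field_simp
        _ ≤ _ := by gcongr
  have hXsq : ∀ o j, _ := fun o j => hsq Ω μ (fun ω => X o ω j)
    ((measurable_pi_apply j).comp (hX.measurable o)) (hasSubgaussianMGF_apply (hX.subGaussian o) j)
  have hesub : ∀ o, HasSubgaussianMGF (eps o) c μ := fun o =>
    HasSubgaussianMGF.mono (hasSubgaussianMGF_of_hasLaw_gaussianReal (heps.gaussian o))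
      ((NNReal.le_toNNReal_of_coe_le (heps.variance_le o.1)).trans le_self_add)
  have hbadle : ∀ j, μ.real (bad j) ≤ 3 * Real.exp (-(m * ℓ)) := fun j =>
    (measureReal_correlation_ge_le hX.measurable hX.indep heps.measurable heps.indep
      heps.indep_design hs (fun o j => (hXsq o j).1) (fun o j => (hXsq o j).2) hesub S j D
      (ht0 j)).trans (exp_add_exp_le hc0 hD0 hm0 hc_n hℓ0 (hrows j).1 hsD (hrows j).2)
  have hunion : μ.real (⋃ j, bad j) ≤ Real.exp (-1 * ℓ) := by
    have hpexp : (p : ℝ) = Real.exp ℓ := (Real.exp_log (by linarith)).symm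
    have hKexp : (K : ℝ) ≤ Real.exp (|M| * ℓ) := by
      rw [← Real.log_le_iff_le_exp (by exact_mod_cast hK)]
      exact hKp.trans (by gcongr; exact le_abs_self M)
    have hK1 : (1 : ℝ) ≤ K := by exact_mod_cast hK
    have h6 : (6 : ℝ) ≤ Real.exp (3 * ℓ) := by
      have : Real.exp (3 * ℓ) = (p : ℝ) ^ 3 := by rw [hpexp, ← Real.exp_nat_mul]; norm_num
      rw [this]
      calc (6 : ℝ) ≤ 2 ^ 3 := by norm_num
        _ ≤ _ := by gcongr
    calc μ.real (⋃ j, bad j) ≤ ∑ j, μ.real (bad j) := measureReal_iUnion_fintype_le _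
      _ ≤ ∑ _j : Coef K p, 3 * Real.exp (-(m * ℓ)) := sum_le_sum fun j _ => hbadle j
      _ = (p + K * p) * (3 * Real.exp (-(m * ℓ))) := by simp
      _ ≤ (K * p + K * p) * (3 * Real.exp (-(m * ℓ))) := by
          gcongr
          nlinarith
      _ = 6 * K * p * Real.exp (-(m * ℓ)) := by ring
      _ ≤ Real.exp (3 * ℓ) * Real.exp (|M| * ℓ) * Real.exp ℓ * Real.exp (-(m * ℓ)) := by
          rw [← hpexp]; gcongr
      _ = Real.exp (-1 * ℓ) := by
          rw [← Real.exp_add, ← Real.exp_add, ← Real.exp_add, hm]; congr 1; ring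
  -- The event involves only design and noise. The initial estimators enter pointwise through
  -- `hacc`, so they may depend on the data arbitrarily.
  refine ⟨(⋃ j, bad j)ᶜ, (MeasurableSet.iUnion hbadm).compl, ?_, fun ω hω hacc => ?_⟩
  · rw [probReal_compl_eq_one_sub (MeasurableSet.iUnion hbadm)]
    linarith
  · refine lassoSolutions_eq_oracleSolutions ha₂ ha (Nat.cast_pos.1 hN0) hlam0 hlam1 hh0 hh hθ hR
      hacc fun j => ?_
    simp only [Set.mem_compl_iff, Set.mem_iUnion, not_exists] at hω
    exact lt_of_not_ge (hω j)
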